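/- Let $\omega$ be a free ultrafilter on $\mathbb{N}$ and let $(n_k)_{k\in\mathbb{N}}$ be a sequence of positive integers with $\lim_k n_k=\infty$. For $A=(a_{ij})\in M_n(\mathbb{C})$ put $\mathrm{Tr}(A)=\frac1n\sum_i a_{ii}$ and $\|A\|_2=\sqrt{\mathrm{Tr}(A^*A)}=\sqrt{\frac1n\sum_{i,j}|a_{ij}|^2}$. Let $\ell^\infty(\mathbb{N},M_{n_k})$ be the $*$-algebra of sequences $(x_k)_k$, $x_k\in M_{n_k}(\mathbb{C})$, that are bounded in operator norm, let $\mathcal{N}_\omega$ be its ideal of sequences with $\lim_{k\to\omega}\|x_k\|_2=0$, and let $\Pi_{k\to\omega}M_{n_k}=\ell^\infty(\mathbb{N},M_{n_k})/\mathcal{N}_\omega$, with the trace $\mathrm{Tr}(\Pi_{k\to\omega}x_k)=\lim_{k\to\omega}\mathrm{Tr}(x_k)$, where $\Pi_{k\to\omega}x_k$ denotes the class of $(x_k)_k$. Let $\Pi_{k\to\omega}P_{n_k}$ be the subgroup of those elements of the unitary group $\mathcal{U}(\Pi_{k\to\omega}M_{n_k})$ that have a representative $(p_k)_k$ in which every $p_k$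 is an $n_k\times n_k$ permutation matrix. Then for every unitary $u\in\mathcal{U}(\Pi_{k\to\omega}M_{n_k})$ the following are equivalent: 1. $u$ is conjugated to an ultraproduct of permutations, i.e. there are $p\in\Pi_{k\to\omega}P_{n_k}$ and a unitary $v\in\mathcal{U}(\Pi_{k\to\omega}M_{n_k})$ with $u=vpv^*$; 2. there is $p\in\Pi_{k\to\omega}P_{n_k}$ such that $\mathrm{Tr}(u^m)=\mathrm{Tr}(p^m)$ for all $m\in\mathbb{Z}$; 3. there is $p\in\Pi_{k\to\omega}P_{n_k}$ such that $\mathrm{Tr}(u^m)=\mathrm{Tr}(p^m)$ for all integers $m\geq 1$. -/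

import Mathlib

open scoped ENNReal Topology Matrix.Norms.L2Operator

namespace MatrixUltraproduct

noncomputable section

/-! ### Normalized trace and trace norm on matrices -/

/-- The normalized trace `Tr A = (1/n) ∑ᵢ aᵢᵢ` on `n × n` complex matrices. -/
def normTrace {n : ℕ} (A : Matrix (Fin n) (Fin n) ℂ) : ℂ :=
  (1 / (n : ℂ)) * ∑ i, A i i

/-- The trace norm `‖A‖₂ = √((1/n) ∑ᵢⱼ |aᵢⱼ|²)` on `n × n` complex matrices. -/
def traceNorm {n : ℕ} (A : Matrix (Fin n) (Fin n) ℂ) : ℝ :=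
  Real.sqrt ((1 / (n : ℝ)) * ∑ i, ∑ j, ‖A i j‖ ^ 2)

lemma traceNorm_eq {n : ℕ} (A : Matrix (Fin n) (Fin n) ℂ) :
    traceNorm A = Real.sqrt (1 / (n : ℝ)) *
      ‖(WithLp.toLp 2 (fun p : Fin n × Fin n => A p.1 p.2) :
        EuclideanSpace ℂ (Fin n × Fin n))‖ := by
  rw [EuclideanSpace.norm_eq, traceNorm, Real.sqrt_mul (by positivity), Fintype.sum_prod_type]

lemma traceNorm_nonneg {n : ℕ} (A : Matrix (Fin n) (Fin n) ℂ) : 0 ≤ traceNorm A :=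
  Real.sqrt_nonneg _

lemma traceNorm_zero {n : ℕ} : traceNorm (0 : Matrix (Fin n) (Fin n) ℂ) = 0 := by
  simp [traceNorm]

lemma traceNorm_add_le {n : ℕ} (A B : Matrix (Fin n) (Fin n) ℂ) :
    traceNorm (A + B) ≤ traceNorm A + traceNorm B := by
  rw [traceNorm_eq, traceNorm_eq, traceNorm_eq, ← mul_add]
  exact mul_le_mul_of_nonneg_left (norm_add_le
    (WithLp.toLp 2 (fun p : Fin n × Fin n => A p.1 p.2) : EuclideanSpace ℂ (Fin n × Fin n))
    (WithLp.toLp 2 (fun p : Fin n × Fin n => B p.1 p.2))) (Real.sqrt_nonneg _)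

lemma traceNorm_star {n : ℕ} (A : Matrix (Fin n) (Fin n) ℂ) :
    traceNorm (star A) = traceNorm A := by
  unfold traceNorm
  rw [Finset.sum_comm]
  simp

lemma traceNorm_mul_le {n : ℕ} (A B : Matrix (Fin n) (Fin n) ℂ) :
    traceNorm (A * B) ≤ ‖A‖ * traceNorm B := by
  have hcol : ∀ j, ∑ i, ‖(A * B) i j‖ ^ 2 ≤ ‖A‖ ^ 2 * ∑ i, ‖B i j‖ ^ 2 := by
    intro j
    have h := Matrix.l2_opNorm_mulVec A (WithLp.toLp 2 (fun i => B i j))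
    have h2 := pow_le_pow_left₀ (norm_nonneg _) h 2
    rw [mul_pow, EuclideanSpace.norm_sq_eq, EuclideanSpace.norm_sq_eq] at h2
    simpa [Matrix.mul_apply, Matrix.mulVec, dotProduct] using h2
  have hsum : ∑ i, ∑ j, ‖(A * B) i j‖ ^ 2 ≤ ‖A‖ ^ 2 * ∑ i, ∑ j, ‖B i j‖ ^ 2 := by
    rw [Finset.sum_comm, Finset.sum_comm (f := fun i j => ‖B i j‖ ^ 2), Finset.mul_sum]
    exact Finset.sum_le_sum fun j _ => hcol j
  unfold traceNorm
  rw [← Real.sqrt_sq (norm_nonneg A), ← Real.sqrt_mul (by positivity)]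
  refine Real.sqrt_le_sqrt ?_
  calc (1 / (n : ℝ)) * ∑ i, ∑ j, ‖(A * B) i j‖ ^ 2
      ≤ (1 / (n : ℝ)) * (‖A‖ ^ 2 * ∑ i, ∑ j, ‖B i j‖ ^ 2) :=
        mul_le_mul_of_nonneg_left hsum (by positivity)
    _ = ‖A‖ ^ 2 * ((1 / (n : ℝ)) * ∑ i, ∑ j, ‖B i j‖ ^ 2) := by ring

lemma traceNorm_mul_le' {n : ℕ} (A B : Matrix (Fin n) (Fin n) ℂ) :
    traceNorm (A * B) ≤ ‖B‖ * traceNorm A := by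
  rw [← traceNorm_star, star_mul, ← norm_star B, ← traceNorm_star A]
  exact traceNorm_mul_le _ _

lemma normTrace_add {n : ℕ} (A B : Matrix (Fin n) (Fin n) ℂ) :
    normTrace (A + B) = normTrace A + normTrace B := by
  simp [normTrace, Finset.sum_add_distrib, mul_add]

lemma norm_normTrace_le {n : ℕ} (A : Matrix (Fin n) (Fin n) ℂ) :
    ‖normTrace A‖ ≤ traceNorm A := by
  unfold normTrace traceNorm
  refine Real.le_sqrt_of_sq_le ?_
  have h1 : ‖∑ i, A i i‖ ^ 2 ≤ (n : ℝ) * ∑ i, ‖A i i‖ ^ 2 := by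
    calc ‖∑ i, A i i‖ ^ 2 ≤ (∑ i, ‖A i i‖) ^ 2 :=
          pow_le_pow_left₀ (norm_nonneg _) (norm_sum_le _ _) 2
      _ ≤ (n : ℝ) * ∑ i, ‖A i i‖ ^ 2 := by
          simpa using sq_sum_le_card_mul_sum_sq (s := Finset.univ) (f := fun i => ‖A i i‖)
  have h2 : ∑ i, ‖A i i‖ ^ 2 ≤ ∑ i, ∑ j, ‖A i j‖ ^ 2 :=
    Finset.sum_le_sum fun i _ => Finset.single_le_sum (f := fun j => ‖A i j‖ ^ 2)
      (fun j _ => sq_nonneg _) (Finset.mem_univ i)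
  rcases Nat.eq_zero_or_pos n with rfl | hn
  · simp
  have hn' : (0 : ℝ) < n := by exact_mod_cast hn
  rw [norm_mul, mul_pow, norm_div, norm_one, Complex.norm_natCast]
  calc (1 / (n : ℝ)) ^ 2 * ‖∑ i, A i i‖ ^ 2
      ≤ (1 / (n : ℝ)) ^ 2 * ((n : ℝ) * ∑ i, ∑ j, ‖A i j‖ ^ 2) :=
        mul_le_mul_of_nonneg_left
          (h1.trans (mul_le_mul_of_nonneg_left h2 hn'.le)) (by positivity)
    _ = (1 / (n : ℝ)) * ∑ i, ∑ j, ‖A i j‖ ^ 2 := by field_simp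

/-! ### The ultraproduct of matrix algebras -/

variable (ω : Ultrafilter ℕ) (n : ℕ → ℕ) [∀ k, NeZero (n k)]

/-- `ℓ^∞(ℕ, M_{n_k})`: sequences of matrices `x_k ∈ M_{n_k}(ℂ)` that are bounded in operator norm,
with the pointwise `*`-algebra operations. -/
abbrev BoundedSeq (n : ℕ → ℕ) : Type :=
  lp (fun k => Matrix (Fin (n k)) (Fin (n k)) ℂ) ∞

/-- The ideal `𝒩_ω` of bounded sequences with `lim_{k → ω} ‖x_k‖₂ = 0`. -/
def nullIdeal : Ideal (BoundedSeq n) where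
  carrier := {x | Filter.Tendsto (fun k => traceNorm (x k)) ω (𝓝 0)}
  zero_mem' := by simp [traceNorm_zero]
  add_mem' := by
    intro x y hx hy
    have h := Filter.Tendsto.add hx hy
    rw [add_zero] at h
    exact squeeze_zero (fun k => traceNorm_nonneg _) (fun k => traceNorm_add_le _ _) h
  smul_mem' := by
    intro c x hx
    have h := Filter.Tendsto.const_mul ‖c‖ hx
    rw [mul_zero] at h
    refine squeeze_zero (fun k => traceNorm_nonneg _) (fun k => ?_) h
    refine (traceNorm_mul_le (c k) (x k)).trans ?_
    exact mul_le_mul_of_nonneg_right (lp.norm_apply_le_norm ENNReal.top_ne_zero c k)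
      (traceNorm_nonneg _)

lemma mem_nullIdeal {x : BoundedSeq n} :
    x ∈ nullIdeal ω n ↔ Filter.Tendsto (fun k => traceNorm (x k)) ω (𝓝 0) := Iff.rfl

instance : (nullIdeal ω n).IsTwoSided where
  mul_mem_of_left := by
    intro x c hx
    have h := Filter.Tendsto.const_mul ‖c‖ hx
    rw [mul_zero] at h
    refine squeeze_zero (fun k => traceNorm_nonneg _) (fun k => ?_) h
    refine (traceNorm_mul_le' (x k) (c k)).trans ?_
    exact mul_le_mul_of_nonneg_right (lp.norm_apply_le_norm ENNReal.top_ne_zero c k)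
      (traceNorm_nonneg _)

lemma star_mem_nullIdeal {x : BoundedSeq n} (hx : x ∈ nullIdeal ω n) :
    star x ∈ nullIdeal ω n := by
  rw [mem_nullIdeal] at hx ⊢
  simpa [traceNorm_star] using hx

/-- The ultraproduct `Π_{k→ω} M_{n_k} = ℓ^∞(ℕ, M_{n_k}) / 𝒩_ω`. -/
def Ultraproduct : Type := BoundedSeq n ⧸ nullIdeal ω n

instance : Ring (Ultraproduct ω n) := Ideal.Quotient.ring (nullIdeal ω n)

instance : Algebra ℂ (Ultraproduct ω n) := Ideal.Quotient.algebra ℂ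

/-- The quotient map: `mk ω n x` is the element `Π_{k→ω} x_k` of the ultraproduct. -/
def mk : BoundedSeq n →+* Ultraproduct ω n := Ideal.Quotient.mk (nullIdeal ω n)

lemma mk_surjective : Function.Surjective (mk ω n) :=
  Ideal.Quotient.mk_surjective

lemma mk_eq_mk_iff {x y : BoundedSeq n} :
    mk ω n x = mk ω n y ↔ Filter.Tendsto (fun k => traceNorm (x k - y k)) ω (𝓝 0) :=
  Ideal.Quotient.eq

/-- The adjoint on the ultraproduct, induced by the entrywise conjugate transpose. -/
instance : StarRing (Ultraproduct ω n) where
  star := Quotient.map' star (by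
    intro x y hxy
    rw [Submodule.quotientRel_def] at hxy ⊢
    rw [← star_sub]
    exact star_mem_nullIdeal ω n hxy)
  star_involutive := by
    intro a
    obtain ⟨x, rfl⟩ := mk_surjective ω n a
    exact congrArg (mk ω n) (star_star x)
  star_mul := by
    intro a b
    obtain ⟨x, rfl⟩ := mk_surjective ω n a
    obtain ⟨y, rfl⟩ := mk_surjective ω n b
    exact congrArg (mk ω n) (star_mul x y)
  star_add := by
    intro a b
    obtain ⟨x, rfl⟩ := mk_surjective ω n a
    obtain ⟨y, rfl⟩ := mk_surjective ω n b
    exact congrArg (mk ω n) (star_add x y)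

lemma star_mk (x : BoundedSeq n) : star (mk ω n x) = mk ω n (star x) := rfl

/-! ### The trace on the ultraproduct -/

/-- `lim_{k→ω} Tr(x_k)` exists for every bounded sequence of matrices. -/
lemma exists_tendsto_normTrace (x : BoundedSeq n) :
    ∃ z : ℂ, Filter.Tendsto (fun k => normTrace (x k)) ω (𝓝 z) := by
  have hb : ∀ k, normTrace (x k) ∈ Metric.closedBall (0 : ℂ) ‖x‖ := by
    intro k
    rw [mem_closedBall_zero_iff]
    have h1 : traceNorm (1 : Matrix (Fin (n k)) (Fin (n k)) ℂ) ≤ 1 := by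
      have : ((n k : ℕ) : ℝ) ≠ 0 := by exact_mod_cast NeZero.ne (n k)
      have hs : ∀ i : Fin (n k),
          ∑ j, ‖(1 : Matrix (Fin (n k)) (Fin (n k)) ℂ) i j‖ ^ 2 = 1 := by
        intro i
        rw [Finset.sum_eq_single i]
        · simp
        · intro j _ hj
          simp [Matrix.one_apply_ne hj.symm]
        · simp
      simp [traceNorm, hs, this]
    calc ‖normTrace (x k)‖ ≤ traceNorm (x k * 1) := by
          rw [mul_one]; exact norm_normTrace_le _
      _ ≤ ‖x k‖ * traceNorm (1 : Matrix (Fin (n k)) (Fin (n k)) ℂ) := traceNorm_mul_le _ _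
      _ ≤ ‖x k‖ := mul_le_of_le_one_right (norm_nonneg _) h1
      _ ≤ ‖x‖ := lp.norm_apply_le_norm ENNReal.top_ne_zero x k
  obtain ⟨z, -, hz⟩ := (isCompact_closedBall (0 : ℂ) ‖x‖).ultrafilter_le_nhds
    (ω.map fun k => normTrace (x k))
    (Filter.le_principal_iff.2 (Filter.mem_map.2 (Filter.Eventually.of_forall hb)))
  exact ⟨z, hz⟩

/-- The trace on the ultraproduct: `Tr(Π_{k→ω} x_k) = lim_{k→ω} Tr(x_k)`. -/
def trace : Ultraproduct ω n → ℂ :=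
  Quotient.lift (fun x : BoundedSeq n => Filter.limUnder (ω : Filter ℕ) fun k => normTrace (x k)) (by
    intro x y hxy
    replace hxy : x - y ∈ nullIdeal ω n := (Submodule.quotientRel_def _).1 hxy
    obtain ⟨z, hz⟩ := exists_tendsto_normTrace ω n y
    have h0 : Filter.Tendsto (fun k => normTrace ((x - y) k)) ω (𝓝 0) :=
      squeeze_zero_norm (fun k => norm_normTrace_le _) hxy
    have hx : Filter.Tendsto (fun k => normTrace (x k)) ω (𝓝 z) := by
      have h := h0.add hz
      rw [zero_add] at h
      refine h.congr fun k => ?_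
      rw [← normTrace_add]
      simp
    change Filter.limUnder _ _ = Filter.limUnder _ _
    rw [hx.limUnder_eq, hz.limUnder_eq])

lemma tendsto_trace (x : BoundedSeq n) :
    Filter.Tendsto (fun k => normTrace (x k)) ω (𝓝 (trace ω n (mk ω n x))) :=
  tendsto_nhds_limUnder (exists_tendsto_normTrace ω n x)

/-! ### The ultraproduct of permutation groups -/

/-- A sequence of permutation matrices, as a bounded sequence of matrices. -/
def permSeq (σ : ∀ k, Equiv.Perm (Fin (n k))) : BoundedSeq n :=
  ⟨fun k => (σ k).permMatrix ℂ, memℓp_infty ⟨1, by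
    rintro _ ⟨k, rfl⟩
    exact Matrix.permMatrix_l2_opNorm_le _⟩⟩

lemma permSeq_one : permSeq n 1 = 1 := by
  refine Subtype.ext (funext fun k => ?_)
  exact Matrix.permMatrix_one

lemma permSeq_mul (σ τ : ∀ k, Equiv.Perm (Fin (n k))) :
    permSeq n (σ * τ) = permSeq n τ * permSeq n σ := by
  refine Subtype.ext (funext fun k => ?_)
  exact Matrix.permMatrix_mul _ _

lemma star_permSeq (σ : ∀ k, Equiv.Perm (Fin (n k))) :
    star (permSeq n σ) = permSeq n σ⁻¹ := by
  refine Subtype.ext (funext fun k => ?_)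
  exact Matrix.conjTranspose_permMatrix _

/-- Every ultraproduct of permutation matrices is a unitary. -/
lemma mk_permSeq_mem_unitary (σ : ∀ k, Equiv.Perm (Fin (n k))) :
    mk ω n (permSeq n σ) ∈ unitary (Ultraproduct ω n) := by
  rw [Unitary.mem_iff, star_mk, star_permSeq, ← map_mul, ← map_mul, ← permSeq_mul,
    ← permSeq_mul, mul_inv_cancel, inv_mul_cancel, permSeq_one, map_one]
  exact ⟨rfl, rfl⟩

/-- `Π_{k→ω} P_{n_k}`: the subgroup of those (unitary) elements of the ultraproduct that have a
representative consisting of permutation matrices. -/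
def permSubgroup : Subgroup (unitary (Ultraproduct ω n)) where
  carrier := {p | ∃ σ : ∀ k, Equiv.Perm (Fin (n k)),
    (p : Ultraproduct ω n) = mk ω n (permSeq n σ)}
  one_mem' := ⟨1, by rw [permSeq_one, map_one]; rfl⟩
  mul_mem' := by
    rintro p q ⟨σ, hσ⟩ ⟨τ, hτ⟩
    exact ⟨τ * σ, by rw [permSeq_mul, map_mul, ← hσ, ← hτ]; rfl⟩
  inv_mem' := by
    rintro p ⟨σ, hσ⟩
    exact ⟨σ⁻¹, by rw [← star_permSeq, ← star_mk, ← hσ]; rfl⟩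

end

end MatrixUltraproduct

namespace MatrixUltraproduct

/-! ### Unitary matrices: diagonalization and unitary invariance of `‖·‖₂` -/

/-! The property of permutations that matters is that they are unitaries: any two unitaries of the
ultraproduct with equal positive moments are conjugate (`exists_unitary_conj_of_trace_pow_eq`). The
converse is invariance of the trace under conjugation.

Both unitaries lift to sequences of unitary matrices, because a matrix `X` can be corrected to a
unitary at `‖·‖₂`-cost at most `‖X* X - 1‖₂` (`exists_unitary_traceNorm_sub_le`). Diagonalizing the
lifts turns moments into averages of characters over eigenvalue angles. Conjugation supplies the
negative moments, and density of trigonometric polynomials then shows that the two empirical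
eigenvalue measures agree asymptotically against every continuous function
(`tendsto_average_of_fourier`).

Hall's theorem upgrades this weak closeness to a bijection between the eigenvalues with small mean
square displacement (`exists_perm_tendsto_average`). Permuting the eigenvectors accordingly and
carrying one eigenbasis to the other gives the conjugating unitary, with `‖·‖₂`-error exactly the
root mean square displacement. -/

/-- Every unitary matrix is unitarily diagonalizable, with eigenvalues written as `exp (i θ)`. -/
lemma exists_unitary_diagonalization {m : ℕ} {U : Matrix (Fin m) (Fin m) ℂ}
    (hU : U ∈ unitary (Matrix (Fin m) (Fin m) ℂ)) :
    ∃ V ∈ unitary (Matrix (Fin m) (Fin m) ℂ), ∃ θ : Fin m → ℝ,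
      U = V * Matrix.diagonal (fun i => Complex.exp (θ i * Complex.I)) * star V := by
  have hn : IsStarNormal U := ⟨by
    rw [commute_iff_eq, (Unitary.mem_iff.1 hU).1, (Unitary.mem_iff.1 hU).2]⟩
  have hspec : ∀ z ∈ spectrum ℂ U, ‖z‖ = 1 := fun z hz => by
    simpa using spectrum.subset_circle_of_unitary hU hz
  -- The spectrum is finite, so every function is continuous on it; the branch cut of `Complex.arg`
  -- does no harm to the functional calculus.
  have hfin : (spectrum ℂ U).Finite := U.finite_spectrum
  have hcont : ∀ f : ℂ → ℂ, ContinuousOn f (spectrum ℂ U) := fun f => hfin.continuousOn f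
  -- A Hermitian logarithm of `U`: the spectral theorem for `H` passes to `U = exp (i H)`.
  set H : Matrix (Fin m) (Fin m) ℂ := cfc (fun z : ℂ => (Complex.arg z : ℂ)) U with hH
  have hHs : H.IsHermitian := by
    change star H = H
    rw [hH, ← cfc_star]
    simp
  have hUH : U = NormedSpace.exp (Complex.I • H) := by
    rw [← CFC.complex_exp_eq_normedSpace_exp (a := Complex.I • H), hH, ← cfc_smul (hf := hcont _),
      ← cfc_comp' (g := Complex.exp) (hf := hcont _)]
    conv_lhs => rw [← cfc_id ℂ U]
    refine cfc_congr fun z hz => ?_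
    have := Complex.norm_mul_exp_arg_mul_I z
    rw [hspec z hz] at this
    simpa [mul_comm] using this.symm
  refine ⟨hHs.eigenvectorUnitary, hHs.eigenvectorUnitary.2, hHs.eigenvalues, ?_⟩
  have hsp := hHs.spectral_theorem
  rw [Unitary.conjStarAlgAut_apply] at hsp
  set V := hHs.eigenvectorUnitary
  have hV1 : (V : Matrix (Fin m) (Fin m) ℂ) * star (V : Matrix (Fin m) (Fin m) ℂ) = 1 :=
    Unitary.coe_mul_star_self V
  have hVinv : (V : Matrix (Fin m) (Fin m) ℂ)⁻¹ = star (V : Matrix (Fin m) (Fin m) ℂ) :=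
    Matrix.inv_eq_right_inv hV1
  rw [hUH]
  conv_lhs => rw [hsp]
  rw [← hVinv, ← smul_mul_assoc, ← mul_smul_comm,
    Matrix.exp_conj _ _ (.of_mul_eq_one _ hV1), ← Matrix.diagonal_smul, Matrix.exp_diagonal]
  congr 3
  funext i
  rw [Pi.coe_exp]
  simp [← Complex.exp_eq_exp_ℂ, mul_comm]

lemma norm_le_one_of_mem_unitary {m : ℕ} {V : Matrix (Fin m) (Fin m) ℂ}
    (hV : V ∈ unitary (Matrix (Fin m) (Fin m) ℂ)) : ‖V‖ ≤ 1 := by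
  rcases subsingleton_or_nontrivial (Matrix (Fin m) (Fin m) ℂ) with h | h
  · simp [Subsingleton.elim V 0]
  · exact (CStarRing.norm_of_mem_unitary hV).le

/-- Conjugation by a unitary matrix does not increase `‖·‖₂`. -/
lemma traceNorm_conj_le {m : ℕ} {V W : Matrix (Fin m) (Fin m) ℂ}
    (hV : V ∈ unitary (Matrix (Fin m) (Fin m) ℂ)) (hW : W ∈ unitary (Matrix (Fin m) (Fin m) ℂ))
    (A : Matrix (Fin m) (Fin m) ℂ) :
    traceNorm (V * A * W) ≤ traceNorm A :=
  calc traceNorm (V * A * W) ≤ ‖W‖ * traceNorm (V * A) := traceNorm_mul_le' _ _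
    _ ≤ traceNorm (V * A) :=
        mul_le_of_le_one_left (traceNorm_nonneg _) (norm_le_one_of_mem_unitary hW)
    _ ≤ ‖V‖ * traceNorm A := traceNorm_mul_le _ _
    _ ≤ traceNorm A :=
        mul_le_of_le_one_left (traceNorm_nonneg _) (norm_le_one_of_mem_unitary hV)

lemma traceNorm_diagonal {m : ℕ} (d : Fin m → ℂ) :
    traceNorm (Matrix.diagonal d) = Real.sqrt ((1 / (m : ℝ)) * ∑ i, ‖d i‖ ^ 2) := by
  unfold traceNorm
  congr 2
  refine Finset.sum_congr rfl fun i _ => ?_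
  rw [Finset.sum_eq_single i (fun j _ hj => by simp [Matrix.diagonal_apply_ne _ hj.symm])
    (by simp), Matrix.diagonal_apply_eq]

lemma normTrace_mul_comm {m : ℕ} (A B : Matrix (Fin m) (Fin m) ℂ) :
    normTrace (A * B) = normTrace (B * A) :=
  congrArg (fun z : ℂ => 1 / (m : ℂ) * z) (Matrix.trace_mul_comm A B)

open scoped ComplexOrder in
/-- Singular value decomposition, with the singular values `√s` where `s` are the eigenvalues of
`X* X`. -/
lemma exists_svd {m : ℕ} (X : Matrix (Fin m) (Fin m) ℂ) :
    ∃ V ∈ unitary (Matrix (Fin m) (Fin m) ℂ), ∃ W ∈ unitary (Matrix (Fin m) (Fin m) ℂ),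
      ∃ s : Fin m → ℝ, (∀ i, 0 ≤ s i) ∧
        star X * X = V * Matrix.diagonal (fun i => (s i : ℂ)) * star V ∧
        X = W * Matrix.diagonal (fun i => (Real.sqrt (s i) : ℂ)) * star V := by
  have hpos : (star X * X).PosSemidef := Matrix.posSemidef_conjTranspose_mul_self X
  have hsp := hpos.1.spectral_theorem
  rw [Unitary.conjStarAlgAut_apply] at hsp
  set V := hpos.1.eigenvectorUnitary
  set s := hpos.1.eigenvalues
  have hs : ∀ i, 0 ≤ s i := hpos.eigenvalues_nonneg
  have hV1 : (V : Matrix (Fin m) (Fin m) ℂ) * star (V : Matrix (Fin m) (Fin m) ℂ) = 1 :=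
    Unitary.coe_mul_star_self V
  have hV2 : star (V : Matrix (Fin m) (Fin m) ℂ) * (V : Matrix (Fin m) (Fin m) ℂ) = 1 :=
    Unitary.coe_star_mul_self V
  -- The columns of `X V` are pairwise orthogonal with squared lengths `s i`. Normalizing the
  -- nonzero ones and completing to an orthonormal basis gives `W`.
  set Y : Matrix (Fin m) (Fin m) ℂ := X * V with hY
  have hYY : star Y * Y = Matrix.diagonal (fun i => (s i : ℂ)) := by
    rw [hY, star_mul, mul_assoc, ← mul_assoc (star X), hsp]
    simp only [← mul_assoc, hV2, one_mul]
    rw [mul_assoc, hV2, mul_one]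
    rfl
  have hYij : ∀ i j, ∑ k, star (Y k i) * Y k j = if i = j then (s i : ℂ) else 0 := fun i j => by
    have := congrFun (congrFun hYY i) j
    rw [Matrix.mul_apply, Matrix.diagonal_apply] at this
    simpa [Matrix.star_apply] using this
  let v : Fin m → EuclideanSpace ℂ (Fin m) := fun i =>
    WithLp.toLp 2 (fun k => ((Real.sqrt (s i) : ℂ))⁻¹ * Y k i)
  have hv : Orthonormal ℂ (Set.domRestrict {i | s i ≠ 0} v) := by
    rw [orthonormal_iff_ite]
    rintro ⟨i, hi⟩ ⟨j, hj⟩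
    have hi' : (0 : ℝ) < s i := lt_of_le_of_ne (hs i) (Ne.symm hi)
    have h1 : inner ℂ (v i) (v j) = (Real.sqrt (s i) : ℂ)⁻¹ * (Real.sqrt (s j) : ℂ)⁻¹ *
        ∑ k, star (Y k i) * Y k j := by
      rw [Finset.mul_sum, PiLp.inner_apply]
      refine Finset.sum_congr rfl fun k _ => ?_
      simp [v]
      ring
    change inner ℂ (v i) (v j) = _
    simp only [h1, hYij, Subtype.mk.injEq]
    split_ifs with h
    · subst h
      rw [← mul_inv, ← Complex.ofReal_mul, Real.mul_self_sqrt (hs i)]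
      exact inv_mul_cancel₀ (by exact_mod_cast hi)
    · simp
  obtain ⟨b, hb⟩ := hv.exists_orthonormalBasis_extension_of_card_eq (by simp)
  refine ⟨V, V.2, (EuclideanSpace.basisFun (Fin m) ℂ).toBasis.toMatrix b.toBasis,
    (EuclideanSpace.basisFun (Fin m) ℂ).toMatrix_orthonormalBasis_mem_unitary b, s, hs, hsp, ?_⟩
  suffices h : Y = (EuclideanSpace.basisFun (Fin m) ℂ).toBasis.toMatrix b.toBasis *
      Matrix.diagonal (fun i => (Real.sqrt (s i) : ℂ)) by
    rw [← h, hY, mul_assoc, hV1, mul_one]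
  ext k i
  rw [Matrix.mul_diagonal]
  have h2 : (EuclideanSpace.basisFun (Fin m) ℂ).toBasis.toMatrix b.toBasis k i = b i k := rfl
  rw [h2]
  -- Where `s i = 0` the basis vector is arbitrary, but the column of `Y` has length zero, so both
  -- sides vanish.
  by_cases hi : s i = 0
  · have h0 := hYij i i
    rw [if_pos rfl, hi] at h0
    have h3 : ∑ k, ‖Y k i‖ ^ 2 = 0 := by
      have : ((∑ k, ‖Y k i‖ ^ 2 : ℝ) : ℂ) = 0 := by
        rw [← Complex.ofReal_zero, ← h0]
        push_cast
        exact Finset.sum_congr rfl fun k _ => (Complex.conj_mul' _).symm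
      exact_mod_cast this
    have h4 := (Finset.sum_eq_zero_iff_of_nonneg (fun _ _ => by positivity)).1 h3 k
      (Finset.mem_univ k)
    simp [hi] at h4 ⊢
    exact h4
  · rw [hb i hi]
    have : (Real.sqrt (s i) : ℂ) ≠ 0 := by
      exact_mod_cast (Real.sqrt_pos.2 (lt_of_le_of_ne (hs i) (Ne.symm hi))).ne'
    simp only [v]
    field_simp

/-- Every matrix `X` is within `‖X* X - 1‖₂` of a unitary matrix. -/
lemma exists_unitary_traceNorm_sub_le {m : ℕ} (X : Matrix (Fin m) (Fin m) ℂ) :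
    ∃ U ∈ unitary (Matrix (Fin m) (Fin m) ℂ), traceNorm (X - U) ≤ traceNorm (star X * X - 1) := by
  obtain ⟨V, hV, W, hW, s, hs, h1, h2⟩ := exists_svd X
  have hV' := Unitary.mem_iff.1 hV
  refine ⟨W * star V, mul_mem hW (Unitary.star_mem hV), ?_⟩
  have e1 : X - W * star V = W * Matrix.diagonal (fun i => (Real.sqrt (s i) : ℂ) - 1) * star V := by
    conv_lhs => rw [h2]
    rw [← Matrix.diagonal_sub, Matrix.diagonal_one, mul_sub, sub_mul, mul_one]
  have e2 : Matrix.diagonal (fun i => (s i : ℂ) - 1) = star V * (star X * X - 1) * V := by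
    rw [h1, ← Matrix.diagonal_sub, Matrix.diagonal_one, mul_sub, sub_mul, mul_one, hV'.1]
    simp only [← mul_assoc, hV'.1, one_mul]
    rw [mul_assoc, hV'.1, mul_one]
  calc traceNorm (X - W * star V)
      ≤ traceNorm (Matrix.diagonal (fun i => (Real.sqrt (s i) : ℂ) - 1)) := by
        rw [e1]; exact traceNorm_conj_le hW (Unitary.star_mem hV) _
    _ ≤ traceNorm (Matrix.diagonal (fun i => (s i : ℂ) - 1)) := by
        rw [traceNorm_diagonal, traceNorm_diagonal]
        refine Real.sqrt_le_sqrt (mul_le_mul_of_nonneg_left (Finset.sum_le_sum fun i _ => ?_)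
          (by positivity))
        refine pow_le_pow_left₀ (norm_nonneg _) ?_ 2
        -- Since `√s + 1 ≥ 1`, this factorization gives `|√s - 1| ≤ |s - 1|`.
        have h3 : (s i : ℂ) - 1 = (Real.sqrt (s i) - 1) * (Real.sqrt (s i) + 1) := by
          have h4 : (s i : ℂ) = (Real.sqrt (s i) : ℂ) * (Real.sqrt (s i) : ℂ) := by
            rw [← Complex.ofReal_mul, Real.mul_self_sqrt (hs i)]
          linear_combination h4
        rw [h3, norm_mul]
        refine le_mul_of_one_le_right (norm_nonneg _) ?_
        rw [← Complex.ofReal_one, ← Complex.ofReal_add, Complex.norm_real]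
        exact le_trans (by linarith [Real.sqrt_nonneg (s i)]) (le_abs_self _)
    _ ≤ traceNorm (star X * X - 1) := by
        rw [e2]; exact traceNorm_conj_le (Unitary.star_mem hV) hV _

end MatrixUltraproduct

namespace MatrixUltraproduct

/-! ### Matching two families of points with close empirical measures -/

/-- Hall's marriage theorem with a deficiency `d`. -/
lemma exists_perm_card_notMem_le {ι : Type*} [Fintype ι] [DecidableEq ι] (t : ι → Finset ι) (d : ℕ)
    (h : ∀ s : Finset ι, s.card ≤ (s.biUnion t).card + d) :
    ∃ σ : Equiv.Perm ι, (Finset.univ.filter fun i => σ i ∉ t i).card ≤ d := by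
  -- Adjoin `d` dummy partners acceptable to every index; a nonempty `s` gains all of them, which
  -- makes up the deficiency in Hall's condition.
  obtain ⟨f, hf, hft⟩ := (Finset.all_card_le_biUnion_card_iff_exists_injective
    (fun i => (t i).disjSum (Finset.univ : Finset (Fin d)))).1 (fun s => by
      rcases s.eq_empty_or_nonempty with rfl | ⟨i₀, hi₀⟩
      · simp
      · have : (s.biUnion t).disjSum (Finset.univ : Finset (Fin d)) ⊆
            s.biUnion fun i => (t i).disjSum (Finset.univ : Finset (Fin d)) := by
          rintro (a | a) ha
          · simpa using ha
          · simpa using ⟨i₀, hi₀⟩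
        have h2 := Finset.card_le_card this
        rw [Finset.card_disjSum, Finset.card_univ, Fintype.card_fin] at h2
        exact (h s).trans h2)
  let g : ι → ι := fun i => Sum.elim id (fun _ => i) (f i)
  have hg : Set.InjOn g (Finset.univ.filter fun i => (f i).isLeft : Finset ι) := by
    intro i hi j hj hij
    simp only [Finset.coe_filter, Finset.mem_univ, true_and, Set.mem_ofPred_eq,
      Sum.isLeft_iff] at hi hj
    obtain ⟨a, ha⟩ := hi
    obtain ⟨b, hb⟩ := hj
    simp only [g, ha, hb, Sum.elim_inl, id] at hij
    exact hf (by rw [ha, hb, hij])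
  obtain ⟨e, he⟩ := Finset.exists_equiv_extend_of_card_eq (t := (Finset.univ : Finset ι)) (by simp)
    (Finset.subset_univ _) hg
  refine ⟨e.trans (Equiv.subtypeUnivEquiv fun i => Finset.mem_univ i), ?_⟩
  rw [← Fintype.card_fin d, ← Finset.card_univ,
    ← Finset.card_map (Function.Embedding.inr : Fin d ↪ ι ⊕ Fin d)]
  -- Every bad index was matched by `f` to a dummy, injectively, so there are at most `d` of them.
  refine Finset.card_le_card_of_injOn f (fun i hi => ?_) hf.injOn
  have hfi := hft i
  rcases hfi' : f i with a | a
  · exfalso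
    have h1 := he i (by simp [hfi'])
    simp only [Finset.coe_filter, Finset.mem_univ, true_and, Set.mem_ofPred_eq] at hi
    apply hi
    change (e i : ι) ∈ t i
    rw [h1]
    simpa [g, hfi'] using hfi
  · simp

/-- In a compact metric space, two families of `m` points whose averages against finitely many test
functions are close can be matched, up to a small proportion, with matched points close. -/
lemma exists_finset_forall_exists_perm (X : Type*) [MetricSpace X] [CompactSpace X] {ε : ℝ}
    (hε : 0 < ε) : ∃ T : Finset C(X, ℝ), ∀ (m : ℕ) (x y : Fin m → X),
      (∀ f ∈ T, |∑ i, (f (x i) - f (y i))| ≤ ε * m) →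
      ∃ σ : Equiv.Perm (Fin m),
        ((Finset.univ.filter fun i => ε ≤ dist (x i) (y (σ i))).card : ℝ) ≤ ε * m := by
  classical
  obtain ⟨c, -, hc⟩ := (isCompact_univ : IsCompact (Set.univ : Set X)).elim_nhds_subcover
    (fun a => Metric.ball a (ε / 4)) (fun a _ => Metric.ball_mem_nhds a (by positivity))
  -- For each set `A` of centres, a bump equal to 1 within `ε / 4` of `A` and to 0 at distance at
  -- least `ε / 2` from it. The cover has finitely many centres, so finitely many bumps suffice as
  -- test functions.
  have key : ∀ A : Finset X, ∃ f : C(X, ℝ), Set.EqOn f 0 (⋂ a ∈ A, {z | ε / 2 ≤ dist z a}) ∧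
      Set.EqOn f 1 (⋃ a ∈ A, Metric.closedBall a (ε / 4)) ∧ ∀ z, f z ∈ Set.Icc (0 : ℝ) 1 := by
    intro A
    refine exists_continuous_zero_one_of_isClosed ?_ ?_ ?_
    · exact isClosed_biInter fun a _ => isClosed_le continuous_const (by fun_prop)
    · exact A.finite_toSet.isClosed_biUnion fun a _ => Metric.isClosed_closedBall
    · rw [Set.disjoint_left]
      intro z hz hz'
      simp only [Set.mem_iInter, Set.mem_ofPred_eq, Set.mem_iUnion, Metric.mem_closedBall,
        exists_prop] at hz hz'
      obtain ⟨a, ha, haz⟩ := hz'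
      linarith [hz a ha]
  choose φ hφ0 hφ1 hφ using key
  refine ⟨c.powerset.image φ, fun m x y h => ?_⟩
  obtain ⟨σ, hσ⟩ := exists_perm_card_notMem_le
    (fun i => Finset.univ.filter fun j => dist (x i) (y j) < ε) ⌊ε * m⌋₊ (fun s => by
      -- With `A` the centres near the points `x i`, `i ∈ s`, the bump is 1 at all these points. It
      -- vanishes at any `y j` at distance at least `ε` from all of them, since such a point is at
      -- least `3ε / 4` from `A`. Comparing the two sums bounds the Hall deficiency by `ε m`.
      set A := c.filter fun a => ∃ i ∈ s, dist (x i) a < ε / 4 with hA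
      have h1 := h (φ A) (Finset.mem_image_of_mem _
        (Finset.mem_powerset.2 (Finset.filter_subset _ _)))
      have h2 : (s.card : ℝ) ≤ ∑ i, φ A (x i) := by
        calc (s.card : ℝ) = ∑ i ∈ s, φ A (x i) := by
              rw [Finset.cast_card]
              refine Finset.sum_congr rfl fun i hi => ?_
              refine (hφ1 A ?_).symm
              have h3 := hc (Set.mem_univ (x i))
              simp only [Set.mem_iUnion, Metric.mem_ball, exists_prop] at h3
              obtain ⟨a, ha, hai⟩ := h3
              exact Set.mem_biUnion (Finset.mem_filter.2 ⟨ha, i, hi, hai⟩) hai.le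
          _ ≤ ∑ i, φ A (x i) :=
              Finset.sum_le_univ_sum_of_nonneg fun i => (hφ A _).1
      have h4 : ∑ j, φ A (y j) ≤
          ((s.biUnion fun i => Finset.univ.filter fun j => dist (x i) (y j) < ε).card : ℝ) := by
        rw [Finset.cast_card, ← Finset.sum_subset (Finset.subset_univ
          (s.biUnion fun i => Finset.univ.filter fun j => dist (x i) (y j) < ε))]
        · exact Finset.sum_le_sum fun j _ => (hφ A _).2
        · intro j _ hj
          refine hφ0 A ?_
          simp only [Finset.mem_biUnion, Finset.mem_filter, Finset.mem_univ, true_and, not_exists,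
            not_and, not_lt] at hj
          simp only [Set.mem_iInter, Set.mem_ofPred_eq]
          intro a ha
          obtain ⟨-, i, hi, hia⟩ := Finset.mem_filter.1 ha
          have := dist_triangle_right (x i) (y j) a
          linarith [hj i hi]
      have h5 : (s.card : ℝ) - ((s.biUnion fun i =>
          Finset.univ.filter fun j => dist (x i) (y j) < ε).card : ℝ) ≤ ε * m := by
        rw [Finset.sum_sub_distrib] at h1
        linarith [le_abs_self (∑ i, φ A (x i) - ∑ i, φ A (y i))]
      have h6 : s.card - (s.biUnion fun i =>
          Finset.univ.filter fun j => dist (x i) (y j) < ε).card ≤ ⌊ε * m⌋₊ := by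
        refine Nat.le_floor ?_
        rcases le_total s.card (s.biUnion fun i =>
          Finset.univ.filter fun j => dist (x i) (y j) < ε).card with h7 | h7
        · rw [Nat.sub_eq_zero_of_le h7, Nat.cast_zero]
          positivity
        · rwa [Nat.cast_sub h7]
      omega)
  refine ⟨σ, le_trans ?_ (Nat.floor_le (by positivity : 0 ≤ ε * m))⟩
  exact_mod_cast le_trans (Finset.card_le_card fun i hi => by simpa using hi) hσ

/-- Families of points with asymptotically equal empirical measures have a matching for which the
mean square distance of the values of `F` tends to zero. -/
lemma exists_perm_tendsto_average {X : Type*} [MetricSpace X] [CompactSpace X] (l : Filter ℕ)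
    (n : ℕ → ℕ) [∀ k, NeZero (n k)] (x y : ∀ k, Fin (n k) → X)
    (h : ∀ f : C(X, ℂ), Filter.Tendsto
      (fun k => (1 / (n k : ℂ)) * ∑ i, (f (x k i) - f (y k i))) l (𝓝 0)) (F : C(X, ℂ)) :
    ∃ σ : ∀ k, Equiv.Perm (Fin (n k)), Filter.Tendsto
      (fun k => (1 / (n k : ℝ)) * ∑ i, ‖F (x k i) - F (y k (σ k i))‖ ^ 2) l (𝓝 0) := by
  classical
  -- The matchings constructed below depend on `ε`; choosing for each `k` a permutation of minimal
  -- cost yields one sequence that is at least as good as all of them.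
  have hmin := fun k => Finite.exists_min
    (fun σ : Equiv.Perm (Fin (n k)) => (1 / (n k : ℝ)) * ∑ i, ‖F (x k i) - F (y k (σ i))‖ ^ 2)
  choose σ hσ using hmin
  refine ⟨σ, ?_⟩
  rw [Metric.tendsto_nhds]
  intro ε hε
  set C : ℝ := (2 * ‖F‖) ^ 2 + 1 with hC
  have hCpos : 0 < C := by positivity
  obtain ⟨δ₀, hδ₀, hF⟩ := Metric.uniformContinuous_iff.1
    (CompactSpace.uniformContinuous_of_continuous F.continuous) (Real.sqrt (ε / 2)) (by positivity)
  -- Pairs closer than `δ₀` cost at most `ε / 2` each. The remaining pairs form a proportion at most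
  -- `ε / (4 * C)` and cost at most `C` each, for a total average of at most `3 * ε / 4`.
  set δ := min δ₀ (ε / (4 * C)) with hδ
  have hδpos : 0 < δ := by positivity
  obtain ⟨T, hT⟩ := exists_finset_forall_exists_perm X hδpos
  have hev : ∀ᶠ k in l, ∀ f ∈ T, |∑ i, (f (x k i) - f (y k i))| ≤ δ * n k := by
    rw [Finset.eventually_all]
    intro f _
    have h1 := h ⟨fun z => (f z : ℂ), by fun_prop⟩
    filter_upwards [Metric.tendsto_nhds.1 h1 δ hδpos] with k hk
    have hn : (0 : ℝ) < n k := by exact_mod_cast Nat.pos_of_ne_zero (NeZero.ne (n k))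
    have h2 : (1 / (n k : ℂ)) * ∑ i, ((f (x k i) : ℂ) - (f (y k i) : ℂ)) =
        (((1 / (n k : ℝ)) * ∑ i, (f (x k i) - f (y k i)) : ℝ) : ℂ) := by push_cast; rfl
    simp only [ContinuousMap.coe_mk, dist_zero_right] at hk
    rw [h2, Complex.norm_real, Real.norm_eq_abs, abs_mul, abs_of_pos (by positivity),
      one_div_mul_eq_div, div_lt_iff₀ hn] at hk
    exact hk.le
  filter_upwards [hev] with k hk
  have hn : (0 : ℝ) < n k := by exact_mod_cast Nat.pos_of_ne_zero (NeZero.ne (n k))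
  obtain ⟨τ, hτ⟩ := hT (n k) (x k) (y k) hk
  rw [dist_zero_right, Real.norm_of_nonneg (by positivity)]
  refine (hσ k τ).trans_lt ?_
  rw [one_div_mul_eq_div, div_lt_iff₀ hn]
  have hterm : ∀ i, ‖F (x k i) - F (y k (τ i))‖ ^ 2 ≤
      ε / 2 + if δ ≤ dist (x k i) (y k (τ i)) then C else 0 := by
    intro i
    split_ifs with hi
    · have h1 : ‖F (x k i) - F (y k (τ i))‖ ≤ 2 * ‖F‖ := by
        refine (norm_sub_le _ _).trans ?_
        linarith [F.norm_coe_le_norm (x k i), F.norm_coe_le_norm (y k (τ i))]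
      have h2 := pow_le_pow_left₀ (norm_nonneg _) h1 2
      linarith
    · have h1 := hF (lt_of_lt_of_le (not_le.1 hi) (min_le_left _ _))
      rw [dist_eq_norm] at h1
      have h2 := pow_le_pow_left₀ (norm_nonneg _) h1.le 2
      rw [Real.sq_sqrt (by positivity)] at h2
      linarith
  calc ∑ i, ‖F (x k i) - F (y k (τ i))‖ ^ 2
      ≤ ∑ i, (ε / 2 + if δ ≤ dist (x k i) (y k (τ i)) then C else 0) :=
        Finset.sum_le_sum fun i _ => hterm i
    _ = n k * (ε / 2) +
        ((Finset.univ.filter fun i => δ ≤ dist (x k i) (y k (τ i))).card : ℝ) * C := by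
        rw [Finset.sum_add_distrib, ← Finset.sum_filter]
        simp
    _ ≤ n k * (ε / 2) + ε / (4 * C) * n k * C := by
        gcongr
        refine hτ.trans ?_
        gcongr
        exact min_le_right _ _
    _ = n k * (3 * ε / 4) := by field_simp; ring
    _ < ε * n k := by nlinarith

/-- If the averages of all characters along two families of points of the circle are asymptotically
equal, so are the averages of all continuous functions. -/
lemma tendsto_average_of_fourier {P : ℝ} [Fact (0 < P)] (l : Filter ℕ)
    (n : ℕ → ℕ) [∀ k, NeZero (n k)] (x y : ∀ k, Fin (n k) → AddCircle P)
    (h : ∀ m : ℤ, Filter.Tendsto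
      (fun k => (1 / (n k : ℂ)) * ∑ i, (fourier m (x k i) - fourier m (y k i))) l (𝓝 0))
    (f : C(AddCircle P, ℂ)) :
    Filter.Tendsto (fun k => (1 / (n k : ℂ)) * ∑ i, (f (x k i) - f (y k i))) l (𝓝 0) := by
  -- The good functions form a subspace containing the characters, hence all trigonometric
  -- polynomials. Uniform approximation finishes, as replacing `f` by `g` changes the average by at
  -- most `2 * ‖f - g‖`.
  let S : Submodule ℂ C(AddCircle P, ℂ) :=
    { carrier := {f | Filter.Tendsto
        (fun k => (1 / (n k : ℂ)) * ∑ i, (f (x k i) - f (y k i))) l (𝓝 0)}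
      zero_mem' := by simpa using tendsto_const_nhds
      add_mem' := by
        intro f g hf hg
        have := Filter.Tendsto.add hf hg
        rw [add_zero] at this
        refine this.congr fun k => ?_
        rw [← mul_add, ← Finset.sum_add_distrib]
        congr 1
        refine Finset.sum_congr rfl fun i _ => ?_
        simp only [ContinuousMap.add_apply]
        ring
      smul_mem' := by
        intro c f hf
        have := Filter.Tendsto.const_mul c hf
        rw [mul_zero] at this
        refine this.congr fun k => ?_
        simp only [ContinuousMap.smul_apply, smul_eq_mul, ← mul_sub, ← Finset.mul_sum]
        ring }
  have hS : Submodule.span ℂ (Set.range (@fourier P)) ≤ S := by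
    rw [Submodule.span_le]
    rintro _ ⟨m, rfl⟩
    exact h m
  have hf : f ∈ (Submodule.span ℂ (Set.range (@fourier P))).topologicalClosure := by
    rw [span_fourier_closure_eq_top]
    trivial
  rw [← SetLike.mem_coe, Submodule.topologicalClosure_coe, Metric.mem_closure_iff] at hf
  rw [Metric.tendsto_nhds]
  intro ε hε
  obtain ⟨g, hg, hfg⟩ := hf (ε / 4) (by positivity)
  have hgS : Filter.Tendsto
      (fun k => (1 / (n k : ℂ)) * ∑ i, (g (x k i) - g (y k i))) l (𝓝 0) := hS hg
  filter_upwards [Metric.tendsto_nhds.1 hgS (ε / 2) (by positivity)] with k hk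
  have hn : (0 : ℝ) < n k := by exact_mod_cast Nat.pos_of_ne_zero (NeZero.ne (n k))
  rw [dist_zero_right] at hk ⊢
  have h1 : (1 / (n k : ℂ)) * ∑ i, (f (x k i) - f (y k i)) =
      (1 / (n k : ℂ)) * ∑ i, (g (x k i) - g (y k i)) +
      (1 / (n k : ℂ)) * ∑ i, ((f - g) (x k i) - (f - g) (y k i)) := by
    rw [← mul_add, ← Finset.sum_add_distrib]
    congr 1
    refine Finset.sum_congr rfl fun i _ => ?_
    simp only [ContinuousMap.sub_apply]
    ring
  have h2 : ‖(1 / (n k : ℂ)) * ∑ i, ((f - g) (x k i) - (f - g) (y k i))‖ ≤ ε / 2 := by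
    rw [norm_mul, norm_div, norm_one, Complex.norm_natCast, one_div_mul_eq_div, div_le_iff₀ hn]
    refine (norm_sum_le _ _).trans ?_
    rw [dist_eq_norm] at hfg
    calc ∑ i, ‖(f - g) (x k i) - (f - g) (y k i)‖ ≤ ∑ _i : Fin (n k), ε / 2 := by
          refine Finset.sum_le_sum fun i _ => (norm_sub_le _ _).trans ?_
          linarith [(f - g).norm_coe_le_norm (x k i), (f - g).norm_coe_le_norm (y k i)]
      _ = ε / 2 * n k := by simp [mul_comm]
  rw [h1]
  exact (norm_add_le _ _).trans_lt (by linarith)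

end MatrixUltraproduct

namespace MatrixUltraproduct

/-! ### Unitaries of the ultraproduct -/

lemma unitary_conj_pow {m : ℕ} {V : Matrix (Fin m) (Fin m) ℂ}
    (hV : V ∈ unitary (Matrix (Fin m) (Fin m) ℂ)) (A : Matrix (Fin m) (Fin m) ℂ) (j : ℕ) :
    (V * A * star V) ^ j = V * A ^ j * star V := by
  induction j with
  | zero => simp [(Unitary.mem_iff.1 hV).2]
  | succ j ih =>
    rw [pow_succ, ih, pow_succ]
    simp only [mul_assoc]
    rw [← mul_assoc (star V) V, (Unitary.mem_iff.1 hV).1, one_mul]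

lemma normTrace_unitary_conj {m : ℕ} {V : Matrix (Fin m) (Fin m) ℂ}
    (hV : V ∈ unitary (Matrix (Fin m) (Fin m) ℂ)) (A : Matrix (Fin m) (Fin m) ℂ) :
    normTrace (V * A * star V) = normTrace A := by
  rw [normTrace_mul_comm, ← mul_assoc, (Unitary.mem_iff.1 hV).1, one_mul]

/-- The moments of a diagonalized matrix are those of its empirical eigenvalue measure, which is how
traces enter the matching problem. -/
lemma normTrace_unitary_conj_diagonal_pow {m : ℕ} {V : Matrix (Fin m) (Fin m) ℂ}
    (hV : V ∈ unitary (Matrix (Fin m) (Fin m) ℂ)) (d : Fin m → ℂ) (j : ℕ) :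
    normTrace ((V * Matrix.diagonal d * star V) ^ j) = (1 / (m : ℂ)) * ∑ i, d i ^ j := by
  rw [unitary_conj_pow hV, normTrace_unitary_conj hV, Matrix.diagonal_pow]
  simp [normTrace]

/-- The diagonal entries in a unitary diagonalization can be permuted. -/
lemma exists_unitary_conj_diagonal_comp {m : ℕ} {W : Matrix (Fin m) (Fin m) ℂ}
    (hW : W ∈ unitary (Matrix (Fin m) (Fin m) ℂ)) (d : Fin m → ℂ) (σ : Equiv.Perm (Fin m)) :
    ∃ V ∈ unitary (Matrix (Fin m) (Fin m) ℂ),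
      W * Matrix.diagonal d * star W = V * Matrix.diagonal (fun i => d (σ i)) * star V := by
  have hW' := Unitary.mem_iff.1 hW
  have hstar : star (W.submatrix id σ) = (star W).submatrix σ id := rfl
  have hd : Matrix.diagonal (fun i => d (σ i)) = (Matrix.diagonal d).submatrix σ σ :=
    (Matrix.submatrix_diagonal_equiv d σ).symm
  -- Permute the columns of `W`, that is, the eigenvectors, along with the eigenvalues.
  refine ⟨W.submatrix id σ, Unitary.mem_iff.2 ⟨?_, ?_⟩, ?_⟩
  · rw [hstar, ← Matrix.submatrix_mul _ _ _ _ _ Function.bijective_id, hW'.1,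
      Matrix.submatrix_one_equiv]
  · rw [hstar, Matrix.submatrix_mul_equiv, hW'.2, Matrix.submatrix_id_id]
  · rw [hstar, hd, Matrix.submatrix_mul_equiv, Matrix.submatrix_mul_equiv, Matrix.submatrix_id_id]

/-- A sequence of unitary matrices, as a bounded sequence of matrices. -/
def unitarySeq (n : ℕ → ℕ) (U : ∀ k, unitary (Matrix (Fin (n k)) (Fin (n k)) ℂ)) : BoundedSeq n :=
  ⟨fun k => U k, memℓp_infty ⟨1, by
    rintro _ ⟨k, rfl⟩
    exact norm_le_one_of_mem_unitary (U k).2⟩⟩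

lemma star_unitarySeq (n : ℕ → ℕ) (U : ∀ k, unitary (Matrix (Fin (n k)) (Fin (n k)) ℂ)) :
    star (unitarySeq n U) = unitarySeq n (star U) := rfl

lemma unitarySeq_mul (n : ℕ → ℕ) (U V : ∀ k, unitary (Matrix (Fin (n k)) (Fin (n k)) ℂ)) :
    unitarySeq n (U * V) = unitarySeq n U * unitarySeq n V := rfl

lemma unitarySeq_one (n : ℕ → ℕ) [∀ k, NeZero (n k)] : unitarySeq n 1 = 1 := rfl

variable (ω : Ultrafilter ℕ) (n : ℕ → ℕ) [∀ k, NeZero (n k)]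

lemma mk_unitarySeq_mem_unitary (U : ∀ k, unitary (Matrix (Fin (n k)) (Fin (n k)) ℂ)) :
    mk ω n (unitarySeq n U) ∈ unitary (Ultraproduct ω n) := by
  have h1 : star U * U = 1 := funext fun k => Unitary.star_mul_self (U k)
  have h2 : U * star U = 1 := funext fun k => Unitary.mul_star_self (U k)
  rw [Unitary.mem_iff, star_mk, star_unitarySeq, ← map_mul, ← map_mul, ← unitarySeq_mul,
    ← unitarySeq_mul, h1, h2, unitarySeq_one, map_one]
  exact ⟨rfl, rfl⟩

/-- Every unitary of the ultraproduct lifts to a sequence of unitary matrices. -/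
lemma exists_unitarySeq_lift (u : unitary (Ultraproduct ω n)) :
    ∃ U : ∀ k, unitary (Matrix (Fin (n k)) (Fin (n k)) ℂ),
      (u : Ultraproduct ω n) = mk ω n (unitarySeq n U) := by
  obtain ⟨x, hx⟩ := mk_surjective ω n u
  have h1 : mk ω n (star x * x) = mk ω n 1 := by
    rw [map_mul, ← star_mk, hx, map_one]
    exact (Unitary.mem_iff.1 u.2).1
  rw [mk_eq_mk_iff] at h1
  choose U hU hxU using fun k => exists_unitary_traceNorm_sub_le (x k)
  refine ⟨fun k => ⟨U k, hU k⟩, ?_⟩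
  rw [← hx, mk_eq_mk_iff]
  exact squeeze_zero (fun k => traceNorm_nonneg _) hxU h1

lemma tendsto_trace_pow (x : BoundedSeq n) (j : ℕ) :
    Filter.Tendsto (fun k => normTrace ((x k) ^ j)) ω (𝓝 (trace ω n (mk ω n x ^ j))) := by
  rw [← map_pow]
  refine (tendsto_trace ω n (x ^ j)).congr fun k => ?_
  rw [lp.infty_coeFn_pow]
  rfl

lemma trace_mul_comm (a b : Ultraproduct ω n) : trace ω n (a * b) = trace ω n (b * a) := by
  obtain ⟨x, rfl⟩ := mk_surjective ω n a
  obtain ⟨y, rfl⟩ := mk_surjective ω n b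
  have h1 := tendsto_trace ω n (x * y)
  have h2 := tendsto_trace ω n (y * x)
  rw [map_mul] at h1 h2
  exact tendsto_nhds_unique (h1.congr fun k => normTrace_mul_comm (x k) (y k)) h2

lemma exp_mul_I_pow_eq_fourier (θ : ℝ) (j : ℕ) :
    Complex.exp (θ * Complex.I) ^ j = fourier (j : ℤ) (θ : AddCircle (2 * Real.pi)) := by
  rw [fourier_coe_apply, ← Complex.exp_nat_mul]
  congr 1
  have : (Real.pi : ℂ) ≠ 0 := by exact_mod_cast Real.pi_ne_zero
  push_cast
  field_simp

/-- Unitaries of the ultraproduct with the same moments are unitarily conjugate. -/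
lemma exists_unitary_conj_of_trace_pow_eq (u w : unitary (Ultraproduct ω n))
    (h : ∀ j : ℕ, 0 < j → trace ω n ((u : Ultraproduct ω n) ^ j) =
      trace ω n ((w : Ultraproduct ω n) ^ j)) :
    ∃ v : unitary (Ultraproduct ω n), u = v * w * star v := by
  have : Fact (0 < 2 * Real.pi) := ⟨Real.two_pi_pos⟩
  obtain ⟨U, hU⟩ := exists_unitarySeq_lift ω n u
  obtain ⟨Q, hQ⟩ := exists_unitarySeq_lift ω n w
  choose V hV θ hθ using fun k => exists_unitary_diagonalization (U k).2
  choose W hW φ hφ using fun k => exists_unitary_diagonalization (Q k).2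
  have hnat : ∀ j : ℕ, Filter.Tendsto (fun k => (1 / (n k : ℂ)) *
      ∑ i, (fourier (j : ℤ) (θ k i : AddCircle (2 * Real.pi)) -
        fourier (j : ℤ) (φ k i : AddCircle (2 * Real.pi)))) ω (𝓝 0) := by
    intro j
    rcases Nat.eq_zero_or_pos j with rfl | hj
    · simp
    have h1 := tendsto_trace_pow ω n (unitarySeq n U) j
    have h2 := tendsto_trace_pow ω n (unitarySeq n Q) j
    rw [← hU, h j hj] at h1
    rw [← hQ] at h2
    have h3 := h1.sub h2
    rw [sub_self] at h3
    refine h3.congr fun k => ?_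
    change normTrace ((U k : Matrix (Fin (n k)) (Fin (n k)) ℂ) ^ j) -
      normTrace ((Q k : Matrix (Fin (n k)) (Fin (n k)) ℂ) ^ j) = _
    rw [hθ k, hφ k, normTrace_unitary_conj_diagonal_pow (hV k),
      normTrace_unitary_conj_diagonal_pow (hW k), ← mul_sub, ← Finset.sum_sub_distrib]
    simp only [exp_mul_I_pow_eq_fourier]
  -- Negative characters are conjugates of positive ones; hence positive moments already determine
  -- the limiting eigenvalue distribution.
  have hint : ∀ j : ℤ, Filter.Tendsto (fun k => (1 / (n k : ℂ)) *
      ∑ i, (fourier j (θ k i : AddCircle (2 * Real.pi)) -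
        fourier j (φ k i : AddCircle (2 * Real.pi)))) ω (𝓝 0) := by
    intro j
    obtain ⟨j, rfl | rfl⟩ := j.eq_nat_or_neg
    · exact hnat j
    · have h1 := (Complex.continuous_conj.tendsto 0).comp (hnat j)
      rw [map_zero] at h1
      refine h1.congr fun k => ?_
      simp only [Function.comp_apply, map_mul, map_div₀, map_one, map_sum, map_sub,
        Complex.conj_natCast, fourier_neg]
  -- The test function `fourier 1` is `θ ↦ exp (i θ)`, so the quantity tending to zero is the mean
  -- square distance between matched eigenvalues.
  obtain ⟨σ, hσ⟩ := exists_perm_tendsto_average (ω : Filter ℕ) n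
    (fun k i => (θ k i : AddCircle (2 * Real.pi))) (fun k i => (φ k i : AddCircle (2 * Real.pi)))
    (tendsto_average_of_fourier (ω : Filter ℕ) n _ _ hint) (fourier 1)
  have hfour : ∀ t : ℝ, fourier 1 (t : AddCircle (2 * Real.pi)) = Complex.exp (t * Complex.I) := by
    intro t
    have := exp_mul_I_pow_eq_fourier t 1
    rw [pow_one] at this
    exact_mod_cast this.symm
  choose R hR hWR using fun k => exists_unitary_conj_diagonal_comp (hW k)
    (fun i => Complex.exp (φ k i * Complex.I)) (σ k)
  -- `V k * star (R k)` carries the reordered eigenbasis of `Q k` to that of `U k`, so after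
  -- conjugation only the diagonal parts differ.
  let v : ∀ k, unitary (Matrix (Fin (n k)) (Fin (n k)) ℂ) :=
    fun k => ⟨V k * star (R k), mul_mem (hV k) (Unitary.star_mem (hR k))⟩
  refine ⟨⟨mk ω n (unitarySeq n v), mk_unitarySeq_mem_unitary ω n v⟩, Subtype.ext ?_⟩
  change (u : Ultraproduct ω n) =
    mk ω n (unitarySeq n v) * (w : Ultraproduct ω n) * star (mk ω n (unitarySeq n v))
  rw [hU, hQ, star_mk, ← map_mul, ← map_mul, mk_eq_mk_iff]
  have hsqrt := hσ.sqrt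
  rw [Real.sqrt_zero] at hsqrt
  refine squeeze_zero (fun k => traceNorm_nonneg _) (fun k => ?_) hsqrt
  have hR' := Unitary.mem_iff.1 (hR k)
  have hconj : V k * star (R k) * (Q k : Matrix (Fin (n k)) (Fin (n k)) ℂ) *
      star (V k * star (R k)) =
      V k * Matrix.diagonal (fun i => Complex.exp (φ k (σ k i) * Complex.I)) * star (V k) := by
    rw [hφ k, hWR k, star_mul, star_star]
    simp only [mul_assoc]
    rw [← mul_assoc (star (R k)) (R k), hR'.1, one_mul, ← mul_assoc (star (R k)) (R k), hR'.1,
      one_mul]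
  change traceNorm ((U k : Matrix (Fin (n k)) (Fin (n k)) ℂ) - V k * star (R k) *
    (Q k : Matrix (Fin (n k)) (Fin (n k)) ℂ) * star (V k * star (R k))) ≤ _
  rw [hconj, hθ k, ← sub_mul, ← mul_sub, Matrix.diagonal_sub]
  refine (traceNorm_conj_le (hV k) (Unitary.star_mem (hV k)) _).trans ?_
  rw [traceNorm_diagonal]
  simp only [hfour]
  exact le_rfl

/-- Conjugate unitaries have the same moments. -/
lemma trace_conj_zpow (p v : unitary (Ultraproduct ω n)) (j : ℤ) :
    trace ω n (((v * p * star v) ^ j : unitary (Ultraproduct ω n)) : Ultraproduct ω n) =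
      trace ω n ((p ^ j : unitary (Ultraproduct ω n)) : Ultraproduct ω n) := by
  have h : (v * p * star v) ^ j = v * p ^ j * star v := conj_zpow
  rw [h]
  push_cast
  rw [trace_mul_comm, ← mul_assoc, Unitary.coe_star_mul_self, one_mul]

end MatrixUltraproduct

theorem mainTheorem5 (ω : Ultrafilter ℕ) (hω : (ω : Filter ℕ) ≤ Filter.cofinite)
    (n : ℕ → ℕ) [∀ k, NeZero (n k)] (hn : Filter.Tendsto n Filter.atTop Filter.atTop)
    (u : unitary (MatrixUltraproduct.Ultraproduct ω n)) :
    ((∃ p ∈ MatrixUltraproduct.permSubgroup ω n,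
        ∃ v : unitary (MatrixUltraproduct.Ultraproduct ω n), u = v * p * star v) ↔
      ∃ p ∈ MatrixUltraproduct.permSubgroup ω n, ∀ k : ℤ,
        MatrixUltraproduct.trace ω n ((u ^ k : unitary (MatrixUltraproduct.Ultraproduct ω n)) :
            MatrixUltraproduct.Ultraproduct ω n) =
          MatrixUltraproduct.trace ω n ((p ^ k : unitary (MatrixUltraproduct.Ultraproduct ω n)) :
            MatrixUltraproduct.Ultraproduct ω n)) ∧
    ((∃ p ∈ MatrixUltraproduct.permSubgroup ω n,
        ∃ v : unitary (MatrixUltraproduct.Ultraproduct ω n), u = v * p * star v) ↔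
      ∃ p ∈ MatrixUltraproduct.permSubgroup ω n, ∀ k : ℕ, 0 < k →
        MatrixUltraproduct.trace ω n ((u : MatrixUltraproduct.Ultraproduct ω n) ^ k) =
          MatrixUltraproduct.trace ω n ((p : MatrixUltraproduct.Ultraproduct ω n) ^ k)) := by
  have h12 : (∃ p ∈ MatrixUltraproduct.permSubgroup ω n,
      ∃ v : unitary (MatrixUltraproduct.Ultraproduct ω n), u = v * p * star v) →
      ∃ p ∈ MatrixUltraproduct.permSubgroup ω n, ∀ k : ℤ,
        MatrixUltraproduct.trace ω n ((u ^ k : unitary (MatrixUltraproduct.Ultraproduct ω n)) :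
            MatrixUltraproduct.Ultraproduct ω n) =
          MatrixUltraproduct.trace ω n ((p ^ k : unitary (MatrixUltraproduct.Ultraproduct ω n)) :
            MatrixUltraproduct.Ultraproduct ω n) := by
    rintro ⟨p, hp, v, rfl⟩
    exact ⟨p, hp, MatrixUltraproduct.trace_conj_zpow ω n p v⟩
  have h31 : (∃ p ∈ MatrixUltraproduct.permSubgroup ω n, ∀ k : ℕ, 0 < k →
        MatrixUltraproduct.trace ω n ((u : MatrixUltraproduct.Ultraproduct ω n) ^ k) =
          MatrixUltraproduct.trace ω n ((p : MatrixUltraproduct.Ultraproduct ω n) ^ k)) →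
      ∃ p ∈ MatrixUltraproduct.permSubgroup ω n,
        ∃ v : unitary (MatrixUltraproduct.Ultraproduct ω n), u = v * p * star v := by
    rintro ⟨p, hp, h⟩
    exact ⟨p, hp, MatrixUltraproduct.exists_unitary_conj_of_trace_pow_eq ω n u p h⟩
  have h23 : (∃ p ∈ MatrixUltraproduct.permSubgroup ω n, ∀ k : ℤ,
        MatrixUltraproduct.trace ω n ((u ^ k : unitary (MatrixUltraproduct.Ultraproduct ω n)) :
            MatrixUltraproduct.Ultraproduct ω n) =
          MatrixUltraproduct.trace ω n ((p ^ k : unitary (MatrixUltraproduct.Ultraproduct ω n)) :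
            MatrixUltraproduct.Ultraproduct ω n)) →
      ∃ p ∈ MatrixUltraproduct.permSubgroup ω n, ∀ k : ℕ, 0 < k →
        MatrixUltraproduct.trace ω n ((u : MatrixUltraproduct.Ultraproduct ω n) ^ k) =
          MatrixUltraproduct.trace ω n ((p : MatrixUltraproduct.Ultraproduct ω n) ^ k) := by
    rintro ⟨p, hp, h⟩
    exact ⟨p, hp, fun k _ => by simpa using h k⟩
  exact ⟨⟨h12, fun h => h31 (h23 h)⟩, ⟨fun h => h23 (h12 h), h31⟩⟩
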